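/- Notation. For a group $G$ and $n\ge 2$ let $\mathcal K(G,n)$ be the kernel of the homomorphism $G^n\to G^{\mathrm{ab}}$, $(g_1,\dots,g_n)\mapsto\overline{g_1\cdots g_n}$. For a presentation $G\cong F/N$ with $F$ a free group, let $\widetilde{\mathcal K}(G,n):=\mathcal K(F,n)/\langle\langle\mathcal K(N,n)\rangle\rangle$, where $\langle\langle\mathcal K(N,n)\rangle\rangle$ is the normal closure of $\mathcal K(N,n)$ in $F^n$; it maps naturally onto $\mathcal K(G,n)$, and for Abelian $G$ one has $\mathcal K(G,2)=\{(g,g^{-1})\mid g\in G\}\cong G$ via the first coordinate. A cover of a finite group $G$ is a group $G^*$ with a surjective homomorphism $G^*\to G$ whose kernel $M$ is contained in $Z(G^*)\cap[G^*,G^*]$ and is isomorphic to the Schur multiplier $H^2(G,\mathbb C^*)$ (trivial action). An Abelian group $G$ has a natural cover if $\widetilde{\mathcal K}(G,2)$ is a cover of $G$, via the natural map $\widetilde{\mathcal K}(G,2)\to\mathcal K(G,2)\cong G$. Theorem 4.4. Let $G$ be a finite Abelian group of odd order. Then $G$ has a natural cover (for every presentation of $G$). More precisely, let $G^*$ be an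 arbitrary cover of $G$ and let $M$ be the kernel of $G^*\to G$. Then $\langle (m,m^{-1})\mid m\in M\rangle$ is a normal subgroup of $\langle (g,g^{-1}),(m,1)\mid g\in G^*,\ m\in M\rangle\le (G^*)^2$ and, for every presentation of $G$ used to form $\widetilde{\mathcal K}(G,2)$, $$\widetilde{\mathcal K}(G,2)\;\cong\;\langle (g,g^{-1}),(m,1)\mid g\in G^*,\ m\in M\rangle\,/\,\langle (m,m^{-1})\mid m\in M\rangle .$$ -/

import Mathlib

universe u v w

/-- The homomorphism `ψ : Gⁿ → Gᵃᵇ` sending `(g₁, …, gₙ)` to the class of `g₁ ⋯ gₙ`. -/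
def productToAb (G : Type u) [Group G] (n : ℕ) : (Fin n → G) →* Abelianization G where
  toFun g := ∏ i, Abelianization.of (g i)
  map_one' := by simp
  map_mul' g h := by simp [Finset.prod_mul_distrib]

/-- The group `𝒦(G, n)`, the kernel of `ψ : Gⁿ → Gᵃᵇ`. -/
def K (G : Type u) [Group G] (n : ℕ) : Subgroup (Fin n → G) := (productToAb G n).ker

/-- For a subgroup `N` of `F`, the group `𝒦(N, n) ≤ Nⁿ` regarded as a subgroup of `Fⁿ`. -/
def KSub {F : Type w} [Group F] (N : Subgroup F) (n : ℕ) : Subgroup (Fin n → F) :=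
  (K N n).map (N.subtype.compLeft (Fin n))

/-- For a free group `F` and a normal subgroup `N` the group
`𝒦̃(F/N, n) = 𝒦(F, n) / ≪𝒦(N, n)≫`, where `≪𝒦(N, n)≫` is the normal closure of `𝒦(N, n)`
inside `Fⁿ` (which is contained in `𝒦(F, n)`). -/
abbrev KTilde {F : Type w} [Group F] (N : Subgroup F) (n : ℕ) : Type w :=
  K F n ⧸ (Subgroup.normalClosure (KSub N n : Set (Fin n → F))).subgroupOf (K F n)

/-- `≪𝒦(N, n)≫` is contained in `𝒦(F, n)`. -/
theorem normalClosure_KSub_le {F : Type w} [Group F] (N : Subgroup F) (n : ℕ) :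
    Subgroup.normalClosure (KSub N n : Set (Fin n → F)) ≤ K F n := by
  have : (K F n).Normal := by unfold K; infer_instance
  refine Subgroup.normalClosure_le_normal ?_
  rintro _ ⟨x, hx, rfl⟩
  have h := congrArg (Abelianization.map N.subtype) (MonoidHom.mem_ker.1 hx)
  simpa [K, productToAb, MonoidHom.mem_ker] using h

/-- Elements of `≪𝒦(N, n)≫` have all their coordinates in `N`. -/
theorem apply_mem_of_mem_normalClosure_KSub {F : Type w} [Group F] (N : Subgroup F) [N.Normal]
    {n : ℕ} (i : Fin n) {x : Fin n → F}
    (hx : x ∈ Subgroup.normalClosure (KSub N n : Set (Fin n → F))) : x i ∈ N := by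
  have hle : Subgroup.normalClosure (KSub N n : Set (Fin n → F)) ≤
      N.comap (Pi.evalMonoidHom (fun _ : Fin n => F) i) := by
    refine Subgroup.normalClosure_le_normal ?_
    rintro _ ⟨y, -, rfl⟩
    exact (y i).2
  exact hle hx

/-- Given a presentation `π : F → G` with kernel `N`, the homomorphism `𝒦̃(G, n) → G` that is the
natural map `𝒦̃(G, n) → 𝒦(G, n) ≤ Gⁿ` followed by the `i`-th coordinate. For `n = 2` and Abelian `G`
the first coordinate is the inverse of the isomorphism `G ≃ 𝒦(G, 2)`, `g ↦ (g, g⁻¹)`. -/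
def KTilde.proj {F : Type w} [Group F] {G : Type u} [Group G] (π : F →* G) {n : ℕ} (i : Fin n) :
    KTilde π.ker n →* G :=
  QuotientGroup.lift _ ((π.comp (Pi.evalMonoidHom (fun _ : Fin n => F) i)).comp (K F n).subtype)
    (fun _ hx => MonoidHom.mem_ker.1
      (apply_mem_of_mem_normalClosure_KSub π.ker i (Subgroup.mem_subgroupOf.1 hx)))

/-- The Schur multiplier `M(G) = H²(G, ℂˣ)`, with `G` acting trivially on `ℂˣ`. (The lifts
only place `ℤ` and `ℂˣ` in the universe of `G`.) -/
noncomputable abbrev SchurMultiplier (G : Type u) [Group G] :=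
  groupCohomology (Rep.trivial (ULift.{u} ℤ) G (ULift.{u} (Additive ℂˣ))) 2

/-- `p : E → G` exhibits `E` as a cover of `G`: it is surjective, its kernel is central, contained
in the commutator subgroup of `E`, and isomorphic to the Schur multiplier of `G`. -/
structure IsCover {E : Type v} [Group E] {G : Type u} [Group G] (p : E →* G) : Prop where
  surjective : Function.Surjective p
  ker_le_center : p.ker ≤ Subgroup.center E
  ker_le_commutator : p.ker ≤ commutator E
  ker_equiv : Nonempty (Additive p.ker ≃+ SchurMultiplier G)

/-- The Abelian group `G` has a natural cover: for every presentation `G ≅ F/N` the group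
`𝒦̃(G, 2)` is a cover of `G`, through its natural map to `𝒦(G, 2) ≅ G`. -/
def HasNaturalCover (G : Type u) [CommGroup G] : Prop :=
  ∀ (F : Type w) [Group F] [IsFreeGroup F] (π : F →* G), Function.Surjective π →
    IsCover (KTilde.proj π (0 : Fin 2))

/-- For a subgroup `M` of `E`, the subgroup `⟨(g, g⁻¹), (m, 1) | g ∈ E, m ∈ M⟩` of `E²`. -/
def warpedNum {E : Type v} [Group E] (M : Subgroup E) : Subgroup (Fin 2 → E) :=
  Subgroup.closure ({x | ∃ g : E, x = ![g, g⁻¹]} ∪ {x | ∃ m ∈ M, x = ![m, 1]})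

/-- For a subgroup `M` of `E`, the subgroup `⟨(m, m⁻¹) | m ∈ M⟩` of `E²`. -/
def warpedDen {E : Type v} [Group E] (M : Subgroup E) : Subgroup (Fin 2 → E) :=
  Subgroup.closure {x | ∃ m ∈ M, x = ![m, m⁻¹]}

/-!
Write `G = F/N` and `Q = F/[F, N]`, a central extension of `G` that maps to every central extension
of `G` because `F` is free. As `N` is central modulo `[F, N]`, the normal closure of `𝒦(N, 2)` in
`F²` is `{(x, y) ∈ N² | xy ∈ [F, N]}` (`mem_normalClosure_KSub_two`).

Since `G` is Abelian, `[F, F] ≤ N`, and the kernel of `𝒦̃(G, 2) → G` is central and consists of the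
classes of `(c, 1)` with `c ∈ [F, F]`; it is isomorphic to `[F, F]/[F, N] = [Q, Q]`
(`KTilde.ker_proj`). The commutator of the classes of `(a, a⁻¹)` and `(b, b⁻¹)` is that of
`([a, b]², 1)`, because `[a⁻¹, b⁻¹] = [a, b]` in `Q`; as `[Q, Q]` has odd exponent, the squares
generate it and the kernel lies in the commutator subgroup (`KTilde.ker_proj_le_commutator`).

It remains to see that `[Q, Q]` is isomorphic to `H²(G, ℂˣ)`
(`nonempty_commutator_addEquiv_schurMultiplier`). The commutator pairing of a cocycle determines its
class, since symmetric cocycles define Abelian extensions, which split as `ℂˣ` is divisible. It is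
given by a character of `[Q, Q]`, since `Q` maps to the extension defined by the cocycle. Conversely
every character of `[Q, Q]` occurs: composed with commutators it is a bilinear alternating map on
`G`, and half of it, which exists because the order is odd, is a cocycle. So `H²(G, ℂˣ)` is dual to
the finite Abelian group `[Q, Q]`.

For a cover `E → G` with kernel `M`, a lift `F → E` induces a surjection from `[Q, Q]` onto
`[E, E] = M`. Both are finite of the same order, so it is bijective
(`mem_commutator_top_ker_of_map_eq_one`). Hence the lift, applied to both coordinates, maps
`𝒦(F, 2)` onto `{(x, y) ∈ E² | xy ∈ M}`, which is the group generated by the `(g, g⁻¹)` and `(m, 1)`,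
and the preimage of `{(m, m⁻¹) | m ∈ M}` is the normal closure of `𝒦(N, 2)`.
-/

open scoped commutatorElement

/-! ### Central extensions and cocycles -/

/-- A 2-cocycle `c` with trivial action gives a central extension `X` of `G` by `A` with a section
`s` such that `s g * s h = c(g, h) * s (g h)`. -/
theorem exists_centralExtension_of_cocycle {G : Type u} {A : Type v} [Group G] [AddCommGroup A]
    (c : G × G → A) (hc : ∀ g h j, c (g * h, j) + c (g, h) = c (h, j) + c (g, h * j)) :
    ∃ (X : Type (max u v)) (_ : Group X) (i : Multiplicative A →* X) (q : X →* G) (s : G → X),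
      Function.Injective i ∧ (∀ a x, i a * x = x * i a) ∧ q.ker = i.range ∧ (∀ g, q (s g) = g) ∧
      ∀ g h, s g * s h = i (Multiplicative.ofAdd (c (g, h))) * s (g * h) := by
  have h1 : ∀ g, c (1, g) = c (1, 1) := fun g => by simpa using (hc 1 1 g).symm
  have h2 : ∀ g, c (g, 1) = c (1, 1) := fun g => by simpa using hc g 1 1
  -- `c` need not be normalized, so the identity of `X` is `(-c(1, 1), 1)`
  let X := A × G
  let : Mul X := ⟨fun x y => (x.1 + y.1 + c (x.2, y.2), x.2 * y.2)⟩
  let : One X := ⟨(-c (1, 1), 1)⟩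
  let : Inv X := ⟨fun x => (-x.1 - c (x.2⁻¹, x.2) - c (1, 1), x.2⁻¹)⟩
  have mul_def : ∀ x y : X, x * y = (x.1 + y.1 + c (x.2, y.2), x.2 * y.2) := fun _ _ => rfl
  have one_def : (1 : X) = (-c (1, 1), 1) := rfl
  have inv_def : ∀ x : X, x⁻¹ = (-x.1 - c (x.2⁻¹, x.2) - c (1, 1), x.2⁻¹) := fun _ => rfl
  let : Group X := Group.ofLeftAxioms
    (fun x y z => by
      simp only [mul_def, mul_assoc]
      have := hc x.2 y.2 z.2
      refine Prod.ext ?_ rfl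
      calc x.1 + y.1 + c (x.2, y.2) + z.1 + c (x.2 * y.2, z.2)
          = x.1 + y.1 + z.1 + (c (x.2 * y.2, z.2) + c (x.2, y.2)) := by abel
        _ = x.1 + (y.1 + z.1 + c (y.2, z.2)) + c (x.2, y.2 * z.2) := by rw [this]; abel)
    (fun x => by ext <;> simp [mul_def, one_def, h1])
    (fun x => by ext <;> simp [mul_def, one_def, inv_def]; abel)
  refine ⟨X, inferInstance,
    { toFun := fun a => (a.toAdd - c (1, 1), 1), map_one' := by simp [one_def],
      map_mul' := fun a b => by ext <;> simp [mul_def]; abel },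
    { toFun := Prod.snd, map_one' := rfl, map_mul' := fun _ _ => rfl },
    fun g => (0, g), ?_, ?_, ?_, fun g => rfl, ?_⟩
  · intro a b hab
    simpa using congrArg Prod.fst hab
  · intro a x
    ext <;> simp [mul_def, h1, h2]; abel
  · ext x
    constructor
    · intro hx
      refine ⟨Multiplicative.ofAdd (x.1 + c (1, 1)), ?_⟩
      ext
      · simp
      · exact (MonoidHom.mem_ker.1 hx).symm
    · rintro ⟨a, rfl⟩
      rfl
  · intro g h
    ext <;> simp [mul_def, h1]

/-- A symmetric cocycle with values in a divisible group is a coboundary: the extension it defines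
is Abelian, hence split. -/
theorem exists_coboundary_of_symm_cocycle {G : Type u} {A : Type v} [CommGroup G] [AddCommGroup A]
    (hA : Module.Baer ℤ A) (c : G × G → A)
    (hc : ∀ g h j, c (g * h, j) + c (g, h) = c (h, j) + c (g, h * j))
    (hsymm : ∀ g h, c (g, h) = c (h, g)) :
    ∃ f : G → A, ∀ g h, c (g, h) = f h - f (g * h) + f g := by
  obtain ⟨X, _, i, q, s, hi, hcen, hker, hqs, hs⟩ := exists_centralExtension_of_cocycle c hc
  have hfac : ∀ x : X, ∃ a g, x = i a * s g := by
    intro x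
    have : x * (s (q x))⁻¹ ∈ q.ker := by simp [MonoidHom.mem_ker, hqs]
    rw [hker] at this
    obtain ⟨a, ha⟩ := this
    exact ⟨a, q x, by rw [ha]; group⟩
  have hss : ∀ g h, s g * s h = s h * s g := fun g h => by rw [hs, hs, hsymm, mul_comm g h]
  have hcomm : ∀ x y : X, x * y = y * x := by
    intro x y
    obtain ⟨a, g, rfl⟩ := hfac x
    obtain ⟨b, h, rfl⟩ := hfac y
    have ha : Commute (i a) (i b * s h) := hcen a _
    have hb : Commute (s g) (i b) := (hcen b _).symm
    exact ha.mul_left (hb.mul_right (hss g h))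
  let : CommGroup X := { ‹Group X› with mul_comm := hcomm }
  obtain ⟨r, hr⟩ := hA.extension_property_addMonoidHom (M := A) (N := Additive X)
    (MonoidHom.toAdditiveRight i) hi (AddMonoidHom.id A)
  have hr' : ∀ a : A, r (Additive.ofMul (i (Multiplicative.ofAdd a))) = a := fun a =>
    DFunLike.congr_fun hr a
  refine ⟨fun g => r (Additive.ofMul (s g)), fun g h => ?_⟩
  have := congrArg (fun x => r (Additive.ofMul x)) (hs g h)
  simp only [ofMul_mul, map_add, hr'] at this
  rw [eq_sub_of_add_eq this.symm]
  abel

/-! ### Commutators in groups that are central over an Abelian group -/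

section CentralByAbelian

variable {E : Type v} [Group E]

theorem commutator_le_ker {G : Type u} [CommGroup G] (p : E →* G) : commutator E ≤ p.ker :=
  Abelianization.commutator_subset_ker p

theorem commutatorElement_mul_left_of_central (hE : commutator E ≤ Subgroup.center E) (x y z : E) :
    ⁅x * y, z⁆ = ⁅x, z⁆ * ⁅y, z⁆ := by
  have h := Subgroup.mem_center_iff.1 (hE (Subgroup.commutator_mem_commutator
    (Subgroup.mem_top y) (Subgroup.mem_top z)))
  calc ⁅x * y, z⁆ = (x * ⁅y, z⁆) * (z * x⁻¹ * z⁻¹) := by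
        simp only [commutatorElement_def]; group
    _ = ⁅y, z⁆ * ⁅x, z⁆ := by rw [h x]; simp only [commutatorElement_def]; group
    _ = ⁅x, z⁆ * ⁅y, z⁆ := (h _).symm

theorem commutatorElement_pow_left_of_central (hE : commutator E ≤ Subgroup.center E) (x z : E)
    (n : ℕ) : ⁅x ^ n, z⁆ = ⁅x, z⁆ ^ n := by
  induction n with
  | zero => simp
  | succ n ih => rw [pow_succ, commutatorElement_mul_left_of_central hE, ih, pow_succ]

theorem commutatorElement_mul_right_of_central (hE : commutator E ≤ Subgroup.center E) (x y z : E) :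
    ⁅x, y * z⁆ = ⁅x, y⁆ * ⁅x, z⁆ := by
  have h := Subgroup.mem_center_iff.1 (hE (Subgroup.commutator_mem_commutator
    (Subgroup.mem_top x) (Subgroup.mem_top y)))
  rw [← commutatorElement_inv, commutatorElement_mul_left_of_central hE, mul_inv_rev,
    commutatorElement_inv, commutatorElement_inv, h]

theorem commutatorElement_inv_inv_of_central (hE : commutator E ≤ Subgroup.center E) (x y : E) :
    ⁅x⁻¹, y⁻¹⁆ = ⁅x, y⁆ := by
  have h1 : ⁅x⁻¹, y⁻¹⁆ * ⁅x, y⁻¹⁆ = 1 := by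
    rw [← commutatorElement_mul_left_of_central hE]; simp
  have h2 : ⁅x, y⁆ * ⁅x, y⁻¹⁆ = 1 := by
    rw [← commutatorElement_mul_right_of_central hE]; simp
  exact mul_right_cancel (h1.trans h2.symm)

theorem commutatorElement_eq_of_map_eq {G : Type u} [Group G] {p : E →* G}
    (hp : p.ker ≤ Subgroup.center E) {x x' y y' : E} (hx : p x = p x') (hy : p y = p y') :
    ⁅x, y⁆ = ⁅x', y'⁆ := by
  have key : ∀ {a a' b : E}, p a = p a' → ⁅a, b⁆ = ⁅a', b⁆ := by
    intro a a' b h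
    have hm : a'⁻¹ * a ∈ p.ker := by simp [MonoidHom.mem_ker, h]
    have hc := Subgroup.mem_center_iff.1 (hp hm)
    obtain ⟨m, rfl⟩ : ∃ m, a = a' * m := ⟨a'⁻¹ * a, by group⟩
    simp only [inv_mul_cancel_left] at hc
    rw [commutatorElement_def, mul_assoc a' m b, ← hc b, commutatorElement_def]
    group
  rw [key hx, ← commutatorElement_inv, key hy, commutatorElement_inv]

/-- If `E` is central over a finite Abelian group `G`, commutators in `E` are bilinear and depend
only on the images in `G`, so the exponent of `[E, E]` divides the order of `G`. -/
theorem pow_eq_one_of_mem_commutator {G : Type u} [CommGroup G] [Finite G] {p : E →* G}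
    (hp : p.ker ≤ Subgroup.center E) {x : E} (hx : x ∈ commutator E) : x ^ Nat.card G = 1 := by
  have hE := (commutator_le_ker p).trans hp
  rw [commutator_eq_closure] at hx
  induction hx using Subgroup.closure_induction with
  | mem x hx =>
    obtain ⟨a, b, rfl⟩ := hx
    rw [← commutatorElement_pow_left_of_central hE,
      commutatorElement_eq_of_map_eq hp (x' := 1) (y' := b) (by simp) rfl]
    simp
  | one => simp
  | mul x y hx hy ihx ihy =>
    rw [← commutator_eq_closure] at hx
    have : Commute x y := (Subgroup.mem_center_iff.1 (hE hx) y).symm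
    rw [this.mul_pow, ihx, ihy, one_mul]
  | inv x _ ih => rw [inv_pow, ih, inv_one]

theorem finite_commutator_of_central {G : Type u} [CommGroup G] [Finite G] {p : E →* G}
    (hp : p.ker ≤ Subgroup.center E) (hsurj : Function.Surjective p) : Finite (commutator E) := by
  have : (commutatorSet E).Finite := by
    refine (Set.finite_range fun z : G × G =>
      ⁅Function.surjInv hsurj z.1, Function.surjInv hsurj z.2⁆).subset ?_
    rintro _ ⟨a, b, rfl⟩
    exact ⟨(p a, p b), commutatorElement_eq_of_map_eq hp (Function.surjInv_eq hsurj _)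
      (Function.surjInv_eq hsurj _)⟩
  have : Finite (commutatorSet E) := this
  infer_instance

end CentralByAbelian

/-! ### The Schur multiplier of an Abelian group of odd order -/

/-- The commutator of two elements, as an element of the commutator subgroup. -/
def commutatorMk {E : Type v} [Group E] (x y : E) : commutator E :=
  ⟨⁅x, y⁆, Subgroup.commutator_mem_commutator (Subgroup.mem_top x) (Subgroup.mem_top y)⟩

theorem closure_commutatorMk (E : Type v) [Group E] :
    Subgroup.closure (Set.range fun z : E × E => commutatorMk z.1 z.2) = ⊤ := by
  apply Subgroup.map_injective (commutator E).subtype_injective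
  rw [MonoidHom.map_closure, ← MonoidHom.range_eq_map, Subgroup.range_subtype]
  refine Eq.trans ?_ (commutator_eq_closure E).symm
  rw [← Set.range_comp]
  congr 1
  ext x
  simp [commutatorMk, commutatorSet_def]

/-- The commutator pairing of a central extension of an Abelian group `G` by `A` given by a
cocycle, read off on a group `E` over `G` that maps to every such extension. -/
theorem exists_hom_commutator_of_cocycle {G : Type u} {A : Type u} {E : Type v} [CommGroup G]
    [AddCommGroup A] [Group E] (p : E →* G)
    (hlift : ∀ (X : Type u) [Group X] (q : X →* G), Function.Surjective q →
      q.ker ≤ Subgroup.center X → ∃ φ : E →* X, q.comp φ = p)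
    (c : G × G → A) (hc : ∀ g h j, c (g * h, j) + c (g, h) = c (h, j) + c (g, h * j)) :
    ∃ χ : commutator E →* Multiplicative A, ∀ x y : E,
      (χ (commutatorMk x y)).toAdd = c (p x, p y) - c (p y, p x) := by
  obtain ⟨X, _, i, q, s, hi, hcen, hker, hqs, hs⟩ := exists_centralExtension_of_cocycle c hc
  have hker' : q.ker ≤ Subgroup.center X := by
    rw [hker]
    rintro _ ⟨a, rfl⟩
    exact Subgroup.mem_center_iff.2 fun x => (hcen a x).symm
  obtain ⟨φ, hφ⟩ := hlift X q (fun g => ⟨s g, hqs g⟩) hker'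
  have hmem : ∀ z : commutator E, φ z ∈ i.range := fun z => by
    rw [← hker, MonoidHom.mem_ker, ← MonoidHom.comp_apply, hφ]
    exact commutator_le_ker p z.2
  let e := MonoidHom.ofInjective hi
  let χ : commutator E →* Multiplicative A :=
    e.symm.toMonoidHom.comp ((φ.comp (commutator E).subtype).codRestrict i.range hmem)
  have hχ : ∀ z, i (χ z) = φ z := fun z => by
    have := e.apply_symm_apply ((φ.comp (commutator E).subtype).codRestrict i.range hmem z)
    exact congrArg Subtype.val this
  refine ⟨χ, fun x y => ?_⟩
  have hcomm : ⁅s (p x), s (p y)⁆ = i (Multiplicative.ofAdd (c (p x, p y) - c (p y, p x))) := by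
    rw [commutatorElement_def, mul_assoc, ← mul_inv_rev, mul_inv_eq_iff_eq_mul, hs, hs,
      ← mul_assoc, ← map_mul i, mul_comm (p x)]
    congr 2
    exact (sub_add_cancel (c (p x, p y)) (c (p y, p x))).symm
  have hqφ : ∀ x, q (φ x) = p x := fun x => DFunLike.congr_fun hφ x
  have : i (χ (commutatorMk x y)) = i (Multiplicative.ofAdd (c (p x, p y) - c (p y, p x))) := by
    rw [hχ, ← hcomm]
    refine (map_commutatorElement φ x y).trans ?_
    exact commutatorElement_eq_of_map_eq hker' (by rw [hqφ, hqs]) (by rw [hqφ, hqs])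
  rw [hi this]
  rfl

/-- For a group `E` that is central over an Abelian group of odd order, every homomorphism from the
commutator subgroup of `E` comes from a cocycle of the quotient. -/
theorem exists_cocycle_of_hom_commutator {G : Type u} {A : Type w} {E : Type v} [CommGroup G]
    [Finite G] (hG : Odd (Nat.card G)) [AddCommGroup A] [Group E] (p : E →* G)
    (hp : p.ker ≤ Subgroup.center E) (hsurj : Function.Surjective p)
    (χ : commutator E →* Multiplicative A) :
    ∃ c : G × G → A, (∀ g h j, c (g * h, j) + c (g, h) = c (h, j) + c (g, h * j)) ∧
      ∀ x y : E, (χ (commutatorMk x y)).toAdd = c (p x, p y) - c (p y, p x) := by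
  have hE := (commutator_le_ker p).trans hp
  obtain ⟨k, hk⟩ := hG
  let b : E → E → A := fun x y => (χ (commutatorMk x y)).toAdd
  have hb : ∀ {x x' y y'}, p x = p x' → p y = p y' → b x y = b x' y' := fun hx hy => by
    simp only [b, commutatorMk, commutatorElement_eq_of_map_eq hp hx hy]
  have hleft : ∀ x y z, b (x * y) z = b x z + b y z := fun x y z => by
    simp only [b, ← toAdd_mul, ← map_mul]
    congr 2
    exact Subtype.ext (commutatorElement_mul_left_of_central hE x y z)
  have hright : ∀ x y z, b x (y * z) = b x y + b x z := fun x y z => by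
    simp only [b, ← toAdd_mul, ← map_mul]
    congr 2
    exact Subtype.ext (commutatorElement_mul_right_of_central hE x y z)
  have hskew : ∀ x y, b y x = - b x y := fun x y => by
    simp only [b, ← toAdd_inv, ← map_inv]
    congr 2
    exact Subtype.ext (commutatorElement_inv x y).symm
  have htors : ∀ x y, (2 * k + 1) • b x y = 0 := fun x y => by
    rw [← hk]
    simp only [b, ← toAdd_pow, ← map_pow]
    have : commutatorMk x y ^ Nat.card G = 1 :=
      Subtype.ext (pow_eq_one_of_mem_commutator hp (commutatorMk x y).2)
    rw [this, map_one]
    rfl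
  let t := Function.surjInv hsurj
  have ht : ∀ g, p (t g) = g := Function.surjInv_eq hsurj
  have htmul : ∀ g h, p (t (g * h)) = p (t g * t h) := fun g h => by simp [ht]
  -- `k + 1` inverts `2` modulo the odd number `2 * k + 1`, so this is half of the pairing `b`
  refine ⟨fun g => (k + 1) • b (t g.1) (t g.2), fun g h j => ?_, fun x y => ?_⟩
  · simp only
    rw [hb (htmul g h) rfl, hb rfl (htmul h j), hleft, hright]
    simp only [smul_add]
    abel
  · simp only
    rw [hb (ht _) (ht _), hb (ht (p y)) (ht (p x)), hskew x y, smul_neg, sub_neg_eq_add, ← add_smul,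
      show k + 1 + (k + 1) = (2 * k + 1) + 1 by ring, add_smul, htors, zero_add, one_smul]

/-- A finite group with commuting elements is isomorphic to its group of complex characters. -/
theorem nonempty_mulEquiv_complex_characters (C : Type v) [Group C] [Finite C]
    (hC : ∀ x y : C, x * y = y * x) : Nonempty ((C →* ℂˣ) ≃* C) := by
  let : CommGroup C := { ‹Group C› with mul_comm := hC }
  exact CommGroup.monoidHom_mulEquiv_of_hasEnoughRootsOfUnity C ℂ

/-- The group `ℂˣ`, written additively and placed in the universe `u`. -/
abbrev AddComplexUnits : Type u := ULift.{u} (Additive ℂˣ)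

theorem baer_addComplexUnits : Module.Baer ℤ AddComplexUnits.{u} := by
  have : ∀ n : ℕ, n ≠ 0 → Function.Surjective fun a : ℂˣ => a ^ n := fun n hn a => by
    obtain ⟨z, hz⟩ := IsAlgClosed.exists_pow_nat_eq (a : ℂ) (Nat.pos_of_ne_zero hn)
    have hz0 : z ≠ 0 := by
      rintro rfl
      exact a.ne_zero (by rw [← hz, zero_pow hn])
    exact ⟨Units.mk0 z hz0, Units.ext (by simpa using hz)⟩
  let : DivisibleBy AddComplexUnits.{u} ℕ := divisibleByOfSMulRightSurj _ _
    fun {n} hn a => by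
      obtain ⟨z, hz⟩ := this n hn a.down.toMul
      exact ⟨⟨Additive.ofMul z⟩, ULift.ext _ _ (congrArg Additive.ofMul hz)⟩
  let : DivisibleBy AddComplexUnits.{u} ℤ := AddGroup.divisibleByIntOfDivisibleByNat _
  exact Module.Baer.of_divisible _

/-- Both the cocycles of `G` and the characters of `[E, E]` give functions on `E × E`: a cocycle `c`
gives its commutator pairing `c(p x, p y) - c(p y, p x)`, a character `χ` gives `χ([x, y])`. The two
ranges agree, the kernel on cocycles consists of the coboundaries, and the map on characters is
injective. Hence `H²(G, ℂˣ)` is the character group of `[E, E]`, which is isomorphic to `[E, E]`. -/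
theorem nonempty_commutator_addEquiv_schurMultiplier {G : Type u} {E : Type v} [CommGroup G]
    [Finite G] (hG : Odd (Nat.card G)) [Group E] (p : E →* G)
    (hp : p.ker ≤ Subgroup.center E) (hsurj : Function.Surjective p)
    (hlift : ∀ (X : Type u) [Group X] (q : X →* G), Function.Surjective q →
      q.ker ≤ Subgroup.center X → ∃ φ : E →* X, q.comp φ = p) :
    Nonempty (Additive (commutator E) ≃+ SchurMultiplier G) := by
  let R := Rep.trivial (ULift.{u} ℤ) G AddComplexUnits.{u}
  have hcoc : ∀ f : G × G → AddComplexUnits.{u}, f ∈ groupCohomology.cocycles₂ R ↔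
      ∀ g h j, f (g * h, j) + f (g, h) = f (h, j) + f (g, h * j) :=
    fun f => groupCohomology.mem_cocycles₂_iff (A := R) f
  -- the commutator pairing of a cocycle
  let Φ : groupCohomology.cocycles₂ R →+ (E × E → AddComplexUnits.{u}) :=
    { toFun := fun c z => (c.1 (p z.1, p z.2) : AddComplexUnits.{u}) -
        (c.1 (p z.2, p z.1) : AddComplexUnits.{u})
      map_zero' := funext fun _ => sub_self (0 : AddComplexUnits.{u})
      map_add' := fun c d => by
        funext z
        exact add_sub_add_comm (c.1 (p z.1, p z.2) : AddComplexUnits.{u})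
          (d.1 (p z.1, p z.2) : AddComplexUnits.{u}) _ _ }
  -- the restriction of a character to commutators
  let Ψ : Additive (commutator E →* Multiplicative AddComplexUnits.{u}) →+
      (E × E → AddComplexUnits.{u}) :=
    { toFun := fun χ z => (χ.toMul (commutatorMk z.1 z.2)).toAdd
      map_zero' := rfl
      map_add' := fun _ _ => rfl }
  have hΨ : Function.Injective Ψ := by
    intro χ₁ χ₂ h
    refine MonoidHom.eq_of_eqOn_dense (f := χ₁.toMul) (g := χ₂.toMul) 
      (closure_commutatorMk E) ?_
    rintro _ ⟨z, rfl⟩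
    exact congrFun h z
  have hrange : Φ.range = AddMonoidHom.range
      (G := Additive (commutator E →* Multiplicative AddComplexUnits.{u})) Ψ := by
    ext f
    constructor
    · rintro ⟨c, rfl⟩
      obtain ⟨χ, hχ⟩ := exists_hom_commutator_of_cocycle p hlift (A := AddComplexUnits.{u})
        c.1 ((hcoc _).1 c.2)
      exact ⟨Additive.ofMul χ, funext fun z => hχ z.1 z.2⟩
    · rintro ⟨χ, rfl⟩
      obtain ⟨c, hc, hχ⟩ := exists_cocycle_of_hom_commutator hG p hp hsurj χ.toMul
      exact ⟨⟨c, (hcoc c).2 hc⟩, funext fun z => (hχ z.1 z.2).symm⟩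
  let π : groupCohomology.cocycles₂ R →+ SchurMultiplier G :=
    (groupCohomology.H2π R).hom.toAddMonoidHom
  have hπ : Function.Surjective π := fun x =>
    groupCohomology.H2_induction_on x fun c => ⟨c, rfl⟩
  have hker : π.ker = Φ.ker := by
    ext c
    rw [AddMonoidHom.mem_ker, AddMonoidHom.mem_ker]
    refine (groupCohomology.H2π_eq_zero_iff c).trans ⟨?_, fun h => ?_⟩
    · rintro ⟨f, hf⟩
      have hf' : ∀ g h, (c.1 (g, h) : AddComplexUnits.{u}) =
          (f h : AddComplexUnits.{u}) - f (g * h) + f g := fun g h =>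
        (congrFun hf (g, h)).symm
      funext z
      refine sub_eq_zero.2 ?_
      rw [hf', hf', mul_comm]
      abel
    · obtain ⟨f, hf⟩ := exists_coboundary_of_symm_cocycle baer_addComplexUnits
        (c.1 : G × G → AddComplexUnits.{u}) ((hcoc _).1 c.2) (fun g h => by
          obtain ⟨x, rfl⟩ := hsurj g
          obtain ⟨y, rfl⟩ := hsurj h
          exact sub_eq_zero.1 (congrFun h (x, y)))
      exact ⟨f, funext fun z => (hf z.1 z.2).symm⟩
  have := finite_commutator_of_central hp hsurj
  have hE := (commutator_le_ker p).trans hp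
  obtain ⟨e⟩ := nonempty_mulEquiv_complex_characters (commutator E) fun x y =>
    Subtype.ext (Subgroup.mem_center_iff.1 (hE y.2) x)
  let eA : Multiplicative AddComplexUnits.{u} ≃* ℂˣ :=
    { toFun := fun a => a.toAdd.down.toMul
      invFun := fun z => Multiplicative.ofAdd ⟨Additive.ofMul z⟩
      left_inv := fun _ => rfl
      right_inv := fun _ => rfl
      map_mul' := fun _ _ => rfl }
  let e₁ : (commutator E →* Multiplicative AddComplexUnits.{u}) ≃* commutator E := (eA.monoidHomCongrRight).trans e
  let e₂ : Additive (commutator E →* Multiplicative AddComplexUnits.{u}) ≃+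
    Additive (commutator E) :=
    { toFun := fun χ => Additive.ofMul (e₁ χ.toMul)
      invFun := fun x => Additive.ofMul (e₁.symm x.toMul)
      left_inv := fun χ => e₁.symm_apply_apply χ.toMul
      right_inv := fun x => e₁.apply_symm_apply x.toMul
      map_add' := fun χ₁ χ₂ => map_mul e₁ χ₁.toMul χ₂.toMul }
  exact ⟨e₂.symm.trans ((AddMonoidHom.ofInjective hΨ).trans
    ((AddEquiv.addSubgroupCongr hrange.symm).trans
      ((QuotientAddGroup.quotientKerEquivRange Φ).symm.trans
        ((QuotientAddGroup.quotientAddEquivOfEq hker.symm).trans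
          (QuotientAddGroup.quotientKerEquivOfSurjective π hπ)))))⟩

/-! ### The free central extension `F/[F, N]` of a presentation -/

section Presentation

variable {F : Type w} [Group F] {G : Type u}

theorem exists_lift_of_isFreeGroup [Group G] [IsFreeGroup F] (π : F →* G) {X : Type v} [Group X]
    (q : X →* G) (hq : Function.Surjective q) : ∃ φ : F →* X, q.comp φ = π := by
  refine ⟨IsFreeGroup.lift fun a => Function.surjInv hq (π (IsFreeGroup.of a)), ?_⟩
  refine IsFreeGroup.ext_hom fun a => ?_
  simp [Function.surjInv_eq hq]

theorem commutator_top_ker_le_ker [Group G] {π : F →* G} {X : Type v} [Group X] {q : X →* G}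
    (hq : q.ker ≤ Subgroup.center X) {φ : F →* X} (hφ : q.comp φ = π) :
    ⁅(⊤ : Subgroup F), π.ker⁆ ≤ φ.ker := by
  rw [Subgroup.commutator_le]
  intro g _ n hn
  have hc : φ n ∈ Subgroup.center X := hq (by
    rw [MonoidHom.mem_ker, ← MonoidHom.comp_apply, hφ]
    exact hn)
  rw [MonoidHom.mem_ker, map_commutatorElement, commutatorElement_eq_one_iff_mul_comm]
  exact Subgroup.mem_center_iff.1 hc _

/-- The map from the free central extension `F/[F, N]` to `F/N`, where `N` is the kernel of `π`. -/
def freeCentralExtension [Group G] (π : F →* G) : F ⧸ ⁅(⊤ : Subgroup F), π.ker⁆ →* G :=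
  QuotientGroup.lift _ π fun _ hx => Subgroup.commutator_le_right ⊤ π.ker hx

theorem mk_mem_center_of_mem {N : Subgroup F} [N.Normal] {n : F} (hn : n ∈ N) :
    (n : F ⧸ ⁅(⊤ : Subgroup F), N⁆) ∈ Subgroup.center (F ⧸ ⁅(⊤ : Subgroup F), N⁆) := by
  refine Subgroup.mem_center_iff.2 fun g => ?_
  obtain ⟨g, rfl⟩ := QuotientGroup.mk_surjective g
  rw [← commutatorElement_eq_one_iff_mul_comm]
  exact (QuotientGroup.eq_one_iff _).2
    (Subgroup.commutator_mem_commutator (Subgroup.mem_top g) hn)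

theorem ker_freeCentralExtension_le_center [Group G] (π : F →* G) :
    (freeCentralExtension π).ker ≤ Subgroup.center _ := by
  intro x hx
  obtain ⟨n, rfl⟩ := QuotientGroup.mk_surjective x
  exact mk_mem_center_of_mem (N := π.ker) hx

theorem freeCentralExtension_surjective [Group G] {π : F →* G} (hπ : Function.Surjective π) :
    Function.Surjective (freeCentralExtension π) := fun g => by
  obtain ⟨f, rfl⟩ := hπ g
  exact ⟨f, rfl⟩

theorem nonempty_commutator_freeCentralExtension_addEquiv_schurMultiplier [CommGroup G] [Finite G]
    (hG : Odd (Nat.card G)) [IsFreeGroup F] (π : F →* G) (hπ : Function.Surjective π) :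
    Nonempty (Additive (commutator (F ⧸ ⁅(⊤ : Subgroup F), π.ker⁆)) ≃+ SchurMultiplier G) := by
  refine nonempty_commutator_addEquiv_schurMultiplier hG (freeCentralExtension π)
    (ker_freeCentralExtension_le_center π) (freeCentralExtension_surjective hπ) fun X _ q hq hc => ?_
  obtain ⟨φ, hφ⟩ := exists_lift_of_isFreeGroup π q hq
  refine ⟨QuotientGroup.lift _ φ fun x hx => commutator_top_ker_le_ker hc hφ hx, ?_⟩
  ext x
  exact DFunLike.congr_fun hφ x

/-- The natural map `[F, F] → [F/[F, N], F/[F, N]]`. -/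
def commutatorToFreeCentralExtension (N : Subgroup F) [N.Normal] :
    commutator F →* commutator (F ⧸ ⁅(⊤ : Subgroup F), N⁆) :=
  ((QuotientGroup.mk' _).comp (commutator F).subtype).codRestrict _ fun c => by
    have := Subgroup.mem_map_of_mem (QuotientGroup.mk' ⁅(⊤ : Subgroup F), N⁆) c.2
    rw [map_commutator_eq] at this
    exact Subgroup.commutator_mono le_top le_top this

theorem commutatorToFreeCentralExtension_surjective (N : Subgroup F) [N.Normal] :
    Function.Surjective (commutatorToFreeCentralExtension N) := by
  rintro ⟨y, hy⟩
  have h := map_commutator_eq F (QuotientGroup.mk' ⁅(⊤ : Subgroup F), N⁆)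
  rw [MonoidHom.range_eq_top.2 (QuotientGroup.mk'_surjective _)] at h
  rw [commutator_def, ← h] at hy
  obtain ⟨c, hc, rfl⟩ := hy
  exact ⟨⟨c, hc⟩, rfl⟩

theorem mem_ker_commutatorToFreeCentralExtension {N : Subgroup F} [N.Normal] {c : commutator F} :
    c ∈ (commutatorToFreeCentralExtension N).ker ↔ (c : F) ∈ ⁅(⊤ : Subgroup F), N⁆ :=
  (MonoidHom.mem_ker.trans Subtype.ext_iff).trans (QuotientGroup.eq_one_iff (c : F))

/-! ### The group `𝒦̃(G, 2)` -/

theorem mem_K_two {x : Fin 2 → F} : x ∈ K F 2 ↔ x 0 * x 1 ∈ commutator F := by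
  rw [K, MonoidHom.mem_ker, ← Abelianization.ker_of, MonoidHom.mem_ker, map_mul]
  simp [productToAb]

/-- Modulo `[F, N]` the subgroup `N` is central, so `(x, y) ↦ xy` is multiplicative on `N × N`
there and the condition `xy ∈ [F, N]` defines a normal subgroup of `F²`. -/
theorem mem_normalClosure_KSub_two {N : Subgroup F} [N.Normal] {x : Fin 2 → F} :
    x ∈ Subgroup.normalClosure (KSub N 2 : Set (Fin 2 → F)) ↔
      x 0 ∈ N ∧ x 1 ∈ N ∧ x 0 * x 1 ∈ ⁅(⊤ : Subgroup F), N⁆ := by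
  have hcen : ∀ {n : F}, n ∈ N → ∀ y : F ⧸ ⁅(⊤ : Subgroup F), N⁆, y * n = n * y :=
    fun hn => Subgroup.mem_center_iff.1 (mk_mem_center_of_mem hn)
  constructor
  · let H : Subgroup (Fin 2 → F) :=
      { carrier := {x | x 0 ∈ N ∧ x 1 ∈ N ∧ x 0 * x 1 ∈ ⁅(⊤ : Subgroup F), N⁆}
        one_mem' := by simp
        mul_mem' := by
          rintro x y ⟨hx0, hx1, hx⟩ ⟨hy0, hy1, hy⟩
          refine ⟨mul_mem hx0 hy0, mul_mem hx1 hy1, ?_⟩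
          rw [← QuotientGroup.eq_one_iff] at hx hy ⊢
          simp only [Pi.mul_apply, QuotientGroup.mk_mul] at hx hy ⊢
          rw [mul_assoc, ← mul_assoc _ _ (y 1 : F ⧸ ⁅(⊤ : Subgroup F), N⁆), hcen hx1, mul_assoc, hy,
            mul_one, hx]
        inv_mem' := by
          rintro x ⟨hx0, hx1, hx⟩
          refine ⟨inv_mem hx0, inv_mem hx1, ?_⟩
          rw [← QuotientGroup.eq_one_iff] at hx ⊢
          simp only [Pi.inv_apply, QuotientGroup.mk_mul, QuotientGroup.mk_inv] at hx ⊢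
          rw [← mul_inv_rev, hcen hx0, hx, inv_one] }
    have hH : H.Normal := by
      refine ⟨fun x hx g => ?_⟩
      obtain ⟨hx0, hx1, hx⟩ := hx
      refine ⟨Subgroup.Normal.conj_mem ‹_› _ hx0 _, Subgroup.Normal.conj_mem ‹_› _ hx1 _, ?_⟩
      rw [← QuotientGroup.eq_one_iff] at hx ⊢
      simp only [Pi.mul_apply, Pi.inv_apply, QuotientGroup.mk_mul, QuotientGroup.mk_inv] at hx ⊢
      rw [hcen hx0, hcen hx1, mul_inv_cancel_right, mul_inv_cancel_right, hx]
    have hle : Subgroup.normalClosure (KSub N 2 : Set (Fin 2 → F)) ≤ H := by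
      refine Subgroup.normalClosure_le_normal ?_
      rintro _ ⟨y, hy, rfl⟩
      refine ⟨(y 0).2, (y 1).2, ?_⟩
      have h := Subgroup.mem_map_of_mem N.subtype (mem_K_two.1 hy)
      rw [Subgroup.map_subtype_commutator] at h
      exact Subgroup.commutator_mono le_top le_rfl h
    exact fun hx => hle hx
  · rintro ⟨-, hx1, hx⟩
    have hanti : ∀ n ∈ N, ![n, n⁻¹] ∈ Subgroup.normalClosure (KSub N 2 : Set (Fin 2 → F)) := by
      intro n hn
      refine Subgroup.subset_normalClosure ⟨![⟨n, hn⟩, ⟨n, hn⟩⁻¹], ?_, ?_⟩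
      · exact mem_K_two.2 (by simp)
      · ext i
        fin_cases i <;> rfl
    have hle : ⁅(⊤ : Subgroup F), N⁆ ≤ (Subgroup.normalClosure (KSub N 2 : Set (Fin 2 → F))).comap
        (MonoidHom.mulSingle (fun _ : Fin 2 => F) 0) := by
      rw [Subgroup.commutator_le]
      intro f _ n hn
      have h := mul_mem (Subgroup.Normal.conj_mem Subgroup.normalClosure_normal _ (hanti n hn)
        ![f, 1]) (hanti n⁻¹ (inv_mem hn))
      have heq : MonoidHom.mulSingle (fun _ : Fin 2 => F) 0 ⁅f, n⁆ =
          ![f, 1] * ![n, n⁻¹] * ![f, 1]⁻¹ * ![n⁻¹, n⁻¹⁻¹] := by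
        ext i
        fin_cases i <;> simp [commutatorElement_def]
      rwa [Subgroup.mem_comap, heq]
    have h := mul_mem (Subgroup.mem_comap.1 (hle hx)) (hanti _ (inv_mem hx1))
    convert h using 1
    ext i
    fin_cases i <;> simp

/-- Equality in `𝒦̃(G, 2)`. -/
theorem KTilde.mk_eq_mk_iff {N : Subgroup F} [N.Normal] {x y : K F 2} :
    (x : KTilde N 2) = y ↔ (x.1 0)⁻¹ * y.1 0 ∈ N ∧ (x.1 1)⁻¹ * y.1 1 ∈ N ∧
      (x.1 0)⁻¹ * y.1 0 * ((x.1 1)⁻¹ * y.1 1) ∈ ⁅(⊤ : Subgroup F), N⁆ := by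
  rw [QuotientGroup.eq, Subgroup.mem_subgroupOf, mem_normalClosure_KSub_two]
  rfl

theorem KTilde.mk_eq_mk_of_commutator {N : Subgroup F} [N.Normal] {x y : K F 2}
    (h : ∀ i, (x.1 i)⁻¹ * y.1 i ∈ ⁅(⊤ : Subgroup F), N⁆) : (x : KTilde N 2) = y :=
  KTilde.mk_eq_mk_iff.2 ⟨Subgroup.commutator_le_right _ _ (h 0),
    Subgroup.commutator_le_right _ _ (h 1), mul_mem (h 0) (h 1)⟩

/-- The homomorphism `[F, F] → 𝒦̃(G, 2)` sending `c` to the class of `(c, 1)`. -/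
def KTilde.ofCommutator (N : Subgroup F) : commutator F →* KTilde N 2 :=
  (QuotientGroup.mk' _).comp (((MonoidHom.mulSingle (fun _ : Fin 2 => F) 0).comp
    (commutator F).subtype).codRestrict (K F 2) fun c => mem_K_two.2 (by simp))

theorem KTilde.ofCommutator_apply (N : Subgroup F) (c : commutator F) :
    KTilde.ofCommutator N c =
      ((⟨![(c : F), 1], mem_K_two.2 (by simp)⟩ : K F 2) : KTilde N 2) := by
  refine congrArg (QuotientGroup.mk' _) (Subtype.ext ?_)
  ext i
  fin_cases i <;> simp

theorem KTilde.mem_ker_ofCommutator {N : Subgroup F} [N.Normal] (hN : commutator F ≤ N)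
    {c : commutator F} :
    c ∈ (KTilde.ofCommutator N).ker ↔ (c : F) ∈ ⁅(⊤ : Subgroup F), N⁆ := by
  rw [MonoidHom.mem_ker, KTilde.ofCommutator_apply, QuotientGroup.eq_one_iff,
    Subgroup.mem_subgroupOf, mem_normalClosure_KSub_two]
  simp only [Matrix.cons_val_zero, Matrix.cons_val_one, mul_one]
  exact ⟨fun h => h.2.2, fun h => ⟨hN c.2, one_mem _, h⟩⟩

theorem KTilde.proj_surjective [CommGroup G] {π : F →* G} (hπ : Function.Surjective π) :
    Function.Surjective (KTilde.proj π (0 : Fin 2)) := fun g => by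
  obtain ⟨f, rfl⟩ := hπ g
  exact ⟨((⟨![f, f⁻¹], mem_K_two.2 (by simp)⟩ : K F 2) : KTilde π.ker 2), rfl⟩

/-- Modulo `≪𝒦(N, 2)≫`, a pair `(x, y)` with `x, y ∈ N` equals `(xy, 1)`, so the kernel of
`𝒦̃(G, 2) → G` is a copy of `[F, F]/[F, N]`. -/
theorem KTilde.ker_proj [CommGroup G] (π : F →* G) :
    (KTilde.proj π (0 : Fin 2)).ker = (KTilde.ofCommutator π.ker).range := by
  have hF := commutator_le_ker π
  ext z
  constructor
  · intro hz
    obtain ⟨x, rfl⟩ := QuotientGroup.mk_surjective z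
    have hx0 : x.1 0 ∈ π.ker := hz
    have hx := mem_K_two.1 x.2
    have hx1 : x.1 1 ∈ π.ker := (Subgroup.mul_mem_cancel_left _ hx0).1 (hF hx)
    refine ⟨⟨_, hx⟩, ?_⟩
    rw [KTilde.ofCommutator_apply, KTilde.mk_eq_mk_iff]
    simp only [Matrix.cons_val_zero, Matrix.cons_val_one, inv_one, one_mul]
    refine ⟨mul_mem (inv_mem (hF hx)) hx0, hx1, ?_⟩
    rw [mul_inv_rev, inv_mul_cancel_right, inv_mul_cancel]
    exact one_mem _
  · rintro ⟨c, rfl⟩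
    rw [KTilde.ofCommutator_apply]
    exact hF c.2

theorem KTilde.ker_proj_le_center [CommGroup G] (π : F →* G) :
    (KTilde.proj π (0 : Fin 2)).ker ≤ Subgroup.center _ := by
  have hF := commutator_le_ker π
  intro z hz
  obtain ⟨x, rfl⟩ := QuotientGroup.mk_surjective z
  have hx0 : x.1 0 ∈ π.ker := hz
  have hx1 : x.1 1 ∈ π.ker := (Subgroup.mul_mem_cancel_left _ hx0).1 (hF (mem_K_two.1 x.2))
  refine Subgroup.mem_center_iff.2 fun z => ?_
  obtain ⟨y, rfl⟩ := QuotientGroup.mk_surjective z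
  refine KTilde.mk_eq_mk_of_commutator (x := y * x) (y := x * y) fun i => ?_
  have hxi : x.1 i ∈ π.ker := by fin_cases i <;> assumption
  have h : (x.1 i : F ⧸ ⁅(⊤ : Subgroup F), π.ker⁆) ∈ Subgroup.center _ := mk_mem_center_of_mem hxi
  rw [← QuotientGroup.eq]
  exact Subgroup.mem_center_iff.1 h (y.1 i)

/-- In `𝒦̃(G, 2)` the commutator of the classes of `(a, a⁻¹)` and `(b, b⁻¹)` is the class of
`([a, b]², 1)`, and `[a, b]` is a power of its square because its order is odd. -/
theorem KTilde.ker_proj_le_commutator [CommGroup G] [Finite G] (hG : Odd (Nat.card G))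
    (π : F →* G) : (KTilde.proj π (0 : Fin 2)).ker ≤ commutator (KTilde π.ker 2) := by
  have hF := commutator_le_ker π
  have hcen := (commutator_le_ker (freeCentralExtension π)).trans
    (ker_freeCentralExtension_le_center π)
  rw [KTilde.ker_proj, MonoidHom.range_eq_map, ← closure_commutatorMk, MonoidHom.map_closure,
    Subgroup.closure_le]
  rintro _ ⟨_, ⟨⟨a, b⟩, rfl⟩, rfl⟩
  have hsq : KTilde.ofCommutator π.ker (commutatorMk a b) ^ 2 ∈ commutator (KTilde π.ker 2) := by
    let d : F → KTilde π.ker 2 := fun f =>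
      ((⟨![f, f⁻¹], mem_K_two.2 (by simp)⟩ : K F 2) : KTilde π.ker 2)
    have hd : ⁅d a, d b⁆ = KTilde.ofCommutator π.ker (commutatorMk a b) ^ 2 := by
      rw [← map_pow, KTilde.ofCommutator_apply]
      have hmem : ⁅a, b⁆ ∈ π.ker := hF (commutatorMk a b).2
      have hmem' : ⁅a⁻¹, b⁻¹⁆ ∈ π.ker := hF (commutatorMk a⁻¹ b⁻¹).2
      refine KTilde.mk_eq_mk_iff (x := ⁅(⟨![a, a⁻¹], mem_K_two.2 (by simp)⟩ : K F 2),
        (⟨![b, b⁻¹], mem_K_two.2 (by simp)⟩ : K F 2)⁆).2 ?_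
      change ⁅a, b⁆⁻¹ * ⁅a, b⁆ ^ 2 ∈ π.ker ∧ ⁅a⁻¹, b⁻¹⁆⁻¹ * 1 ∈ π.ker ∧
        ⁅a, b⁆⁻¹ * ⁅a, b⁆ ^ 2 * (⁅a⁻¹, b⁻¹⁆⁻¹ * 1) ∈ ⁅(⊤ : Subgroup F), π.ker⁆
      refine ⟨mul_mem (inv_mem hmem) (pow_mem hmem 2), mul_mem (inv_mem hmem') (one_mem _), ?_⟩
      rw [mul_one, pow_two, inv_mul_cancel_left, ← QuotientGroup.eq_one_iff,
        QuotientGroup.mk_mul, QuotientGroup.mk_inv, mul_inv_eq_one]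
      exact (commutatorElement_inv_inv_of_central hcen
        (a : F ⧸ ⁅(⊤ : Subgroup F), π.ker⁆) (b : F ⧸ ⁅(⊤ : Subgroup F), π.ker⁆)).symm
    rw [← hd]
    exact Subgroup.commutator_mem_commutator (Subgroup.mem_top _) (Subgroup.mem_top _)
  have htors : KTilde.ofCommutator π.ker (commutatorMk a b) ^ Nat.card G = 1 := by
    rw [← map_pow, ← MonoidHom.mem_ker, KTilde.mem_ker_ofCommutator hF,
      ← mem_ker_commutatorToFreeCentralExtension, MonoidHom.mem_ker, map_pow]
    exact Subtype.ext (pow_eq_one_of_mem_commutator (ker_freeCentralExtension_le_center π)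
      (commutatorToFreeCentralExtension π.ker (commutatorMk a b)).2)
  obtain ⟨k, hk⟩ := hG
  have hpow := pow_mem hsq (k + 1)
  rwa [← pow_mul, show 2 * (k + 1) = Nat.card G + 1 by omega, pow_succ, htors, one_mul] at hpow

theorem KTilde.isCover_proj [CommGroup G] [Finite G] (hG : Odd (Nat.card G)) [IsFreeGroup F]
    (π : F →* G) (hπ : Function.Surjective π) : IsCover (KTilde.proj π (0 : Fin 2)) where
  surjective := KTilde.proj_surjective hπ
  ker_le_center := KTilde.ker_proj_le_center π
  ker_le_commutator := KTilde.ker_proj_le_commutator hG π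
  ker_equiv := by
    obtain ⟨e⟩ := nonempty_commutator_freeCentralExtension_addEquiv_schurMultiplier hG π hπ
    have hker : (KTilde.ofCommutator π.ker).ker = (commutatorToFreeCentralExtension π.ker).ker := by
      ext c
      rw [KTilde.mem_ker_ofCommutator (commutator_le_ker π),
        mem_ker_commutatorToFreeCentralExtension]
    let e' : (KTilde.proj π (0 : Fin 2)).ker ≃* commutator (F ⧸ ⁅(⊤ : Subgroup F), π.ker⁆) :=
      (MulEquiv.subgroupCongr (KTilde.ker_proj π)).trans
        ((QuotientGroup.quotientKerEquivRange _).symm.trans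
          ((QuotientGroup.quotientMulEquivOfEq hker).trans
            (QuotientGroup.quotientKerEquivOfSurjective _
              (commutatorToFreeCentralExtension_surjective _))))
    exact ⟨e'.toAdditive.trans e⟩

end Presentation

/-! ### Comparison with an arbitrary cover -/

section Cover

variable {E : Type v} [Group E] {G : Type u}

/-- For the kernel of `p`, the generated subgroup is the full preimage of `𝒦(G, 2)`. -/
theorem mem_warpedNum_ker [CommGroup G] {p : E →* G} {x : Fin 2 → E} :
    x ∈ warpedNum p.ker ↔ p (x 0) * p (x 1) = 1 := by
  constructor
  · intro hx
    rw [warpedNum] at hx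
    induction hx using Subgroup.closure_induction with
    | mem x hx =>
      obtain ⟨g, rfl⟩ | ⟨m, hm, rfl⟩ := hx
      · simp
      · simpa using hm
    | one => simp
    | mul x y _ _ hx hy =>
      rw [Pi.mul_apply, Pi.mul_apply, map_mul, map_mul, mul_mul_mul_comm, hx, hy, one_mul]
    | inv x _ hx => rw [Pi.inv_apply, Pi.inv_apply, map_inv, map_inv, ← mul_inv, hx, inv_one]
  · intro hx
    have h1 : ![x 0 * x 1, 1] ∈ warpedNum p.ker := Subgroup.subset_closure
      (Or.inr ⟨_, by rwa [MonoidHom.mem_ker, map_mul], rfl⟩)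
    have h2 : ![(x 1)⁻¹, (x 1)⁻¹⁻¹] ∈ warpedNum p.ker := Subgroup.subset_closure
      (Or.inl ⟨_, rfl⟩)
    convert mul_mem h1 h2 using 1
    ext i
    fin_cases i <;> simp

theorem mem_warpedDen {M : Subgroup E} (hM : M ≤ Subgroup.center E) {x : Fin 2 → E} :
    x ∈ warpedDen M ↔ x 0 ∈ M ∧ x 0 * x 1 = 1 := by
  constructor
  · intro hx
    rw [warpedDen] at hx
    induction hx using Subgroup.closure_induction with
    | mem x hx =>
      obtain ⟨m, hm, rfl⟩ := hx
      exact ⟨hm, by simp⟩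
    | one => exact ⟨one_mem _, by simp⟩
    | mul x y _ _ hx hy =>
      refine ⟨mul_mem hx.1 hy.1, ?_⟩
      rw [Pi.mul_apply, Pi.mul_apply, mul_assoc, ← mul_assoc (y 0),
        ← Subgroup.mem_center_iff.1 (hM hy.1) (x 1), mul_assoc, hy.2, mul_one, hx.2]
    | inv x _ hx =>
      refine ⟨inv_mem hx.1, ?_⟩
      rw [Pi.inv_apply, Pi.inv_apply, ← mul_inv_rev, Subgroup.mem_center_iff.1 (hM hx.1), hx.2,
        inv_one]
  · rintro ⟨h0, h1⟩
    refine Subgroup.subset_closure ⟨x 0, h0, ?_⟩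
    ext i
    fin_cases i
    · rfl
    · exact (inv_eq_of_mul_eq_one_right h1).symm

theorem warpedDen_le_warpedNum [CommGroup G] {p : E →* G} (hp : p.ker ≤ Subgroup.center E) :
    warpedDen p.ker ≤ warpedNum p.ker := fun x hx => by
  rw [mem_warpedNum_ker, ← map_mul, ((mem_warpedDen hp).1 hx).2, map_one]

theorem warpedDen_normal {M : Subgroup E} (hM : M ≤ Subgroup.center E) : (warpedDen M).Normal := by
  refine ⟨fun x hx g => ?_⟩
  obtain ⟨h0, h1⟩ := (mem_warpedDen hM).1 hx
  have hcen0 := Subgroup.mem_center_iff.1 (hM h0)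
  have hcen1 := Subgroup.mem_center_iff.1
    (hM ((eq_inv_of_mul_eq_one_right h1) ▸ inv_mem h0 : x 1 ∈ M))
  convert hx using 1
  ext i
  fin_cases i
  · change g 0 * x 0 * (g 0)⁻¹ = x 0
    rw [hcen0, mul_inv_cancel_right]
  · change g 1 * x 1 * (g 1)⁻¹ = x 1
    rw [hcen1, mul_inv_cancel_right]

theorem IsCover.ker_eq_commutator [CommGroup G] {p : E →* G} (hp : IsCover p) :
    p.ker = commutator E :=
  le_antisymm hp.ker_le_commutator (commutator_le_ker p)

variable {F : Type w} [Group F] [CommGroup G]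

theorem exists_mem_commutator_map_eq {π : F →* G} (hπ : Function.Surjective π) {p : E →* G}
    (hp : p.ker ≤ Subgroup.center E) {φ : F →* E} (hφ : p.comp φ = π) {y : E}
    (hy : y ∈ commutator E) : ∃ c ∈ commutator F, φ c = y := by
  suffices commutator E ≤ (commutator F).map φ from this hy
  rw [commutator_eq_closure, Subgroup.closure_le]
  rintro _ ⟨x, y, rfl⟩
  obtain ⟨a, ha⟩ := hπ (p x)
  obtain ⟨b, hb⟩ := hπ (p y)
  refine ⟨⁅a, b⁆, (commutatorMk a b).2, ?_⟩
  rw [map_commutatorElement]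
  exact commutatorElement_eq_of_map_eq hp
    ((DFunLike.congr_fun hφ a).trans ha) ((DFunLike.congr_fun hφ b).trans hb)

/-- A lift `φ : F → E` of a presentation to a cover is injective on `[F, F]/[F, N]`: it maps this
group onto `[E, E]`, and both groups have the order of the Schur multiplier. -/
theorem mem_commutator_top_ker_of_map_eq_one [Finite G] (hG : Odd (Nat.card G)) [IsFreeGroup F]
    {π : F →* G} (hπ : Function.Surjective π) {p : E →* G} (hp : IsCover p) {φ : F →* E}
    (hφ : p.comp φ = π) {c : F} (hc : c ∈ commutator F) (h : φ c = 1) :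
    c ∈ ⁅(⊤ : Subgroup F), π.ker⁆ := by
  obtain ⟨e⟩ := nonempty_commutator_freeCentralExtension_addEquiv_schurMultiplier hG π hπ
  obtain ⟨e'⟩ := hp.ker_equiv
  have := finite_commutator_of_central (ker_freeCentralExtension_le_center π)
    (freeCentralExtension_surjective hπ)
  let φ' : F ⧸ ⁅(⊤ : Subgroup F), π.ker⁆ →* E :=
    QuotientGroup.lift _ φ fun x hx => commutator_top_ker_le_ker hp.ker_le_center hφ hx
  let ψ : commutator (F ⧸ ⁅(⊤ : Subgroup F), π.ker⁆) → p.ker := fun z => ⟨φ' z, by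
    have := Subgroup.mem_map_of_mem φ' z.2
    rw [map_commutator_eq] at this
    rw [hp.ker_eq_commutator]
    exact Subgroup.commutator_mono le_top le_top this⟩
  have hψ : Function.Surjective ψ := by
    rintro ⟨y, hy⟩
    obtain ⟨d, hd, rfl⟩ := exists_mem_commutator_map_eq hπ hp.ker_le_center hφ
      (hp.ker_le_commutator hy)
    exact ⟨commutatorToFreeCentralExtension π.ker ⟨d, hd⟩, rfl⟩
  let f : commutator (F ⧸ ⁅(⊤ : Subgroup F), π.ker⁆) ≃ p.ker :=
    (Additive.ofMul.trans (e.trans e'.symm).toEquiv).trans Additive.toMul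
  have hinj := (Finite.injective_iff_surjective_of_equiv f).2 hψ
  rw [← mem_ker_commutatorToFreeCentralExtension (c := ⟨c, hc⟩), MonoidHom.mem_ker]
  refine hinj (Subtype.ext ?_)
  exact h.trans (map_one φ').symm

/-- A lift `φ : F → E` of the presentation, applied to both coordinates, induces the isomorphism. -/
theorem nonempty_KTilde_mulEquiv [Finite G] (hG : Odd (Nat.card G)) [IsFreeGroup F]
    {π : F →* G} (hπ : Function.Surjective π) {p : E →* G} (hp : IsCover p)
    [((warpedDen p.ker).subgroupOf (warpedNum p.ker)).Normal] :
    Nonempty (KTilde π.ker 2 ≃*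
      warpedNum p.ker ⧸ (warpedDen p.ker).subgroupOf (warpedNum p.ker)) := by
  obtain ⟨φ, hφ⟩ := exists_lift_of_isFreeGroup π p hp.surjective
  have hpφ : ∀ f, p (φ f) = π f := fun f => DFunLike.congr_fun hφ f
  have hF := commutator_le_ker π
  let θ : K F 2 →* warpedNum p.ker :=
    ((φ.compLeft (Fin 2)).comp (K F 2).subtype).codRestrict _ fun x => mem_warpedNum_ker.2 (by
      have := hF (mem_K_two.1 x.2)
      rw [MonoidHom.mem_ker, map_mul, ← hpφ, ← hpφ] at this
      exact this)
  have hφsurj : Function.Surjective φ := fun y => by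
    obtain ⟨a, ha⟩ := hπ (p y)
    have : (φ a)⁻¹ * y ∈ p.ker := by
      rw [MonoidHom.mem_ker, map_mul, map_inv, hpφ, ha, inv_mul_cancel]
    obtain ⟨c, -, hc⟩ := exists_mem_commutator_map_eq hπ hp.ker_le_center hφ
      (hp.ker_le_commutator this)
    exact ⟨a * c, by rw [map_mul, hc, mul_inv_cancel_left]⟩
  have hθ : Function.Surjective θ := by
    rintro ⟨y, hy⟩
    have hy' : y 0 * y 1 ∈ p.ker := by
      rw [MonoidHom.mem_ker, map_mul]
      exact mem_warpedNum_ker.1 hy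
    obtain ⟨a, ha⟩ := hφsurj (y 0)
    obtain ⟨c, hc, hcy⟩ := exists_mem_commutator_map_eq hπ hp.ker_le_center hφ
      (hp.ker_le_commutator hy')
    -- the second coordinate is corrected by `c` so that the pair lies in `𝒦(F, 2)`
    refine ⟨⟨![a, a⁻¹ * c], mem_K_two.2 (by simpa using hc)⟩, Subtype.ext ?_⟩
    ext i
    fin_cases i
    · exact ha
    · change φ (a⁻¹ * c) = y 1
      rw [map_mul, map_inv, hcy, ha, inv_mul_cancel_left]
  let Θ := (QuotientGroup.mk' ((warpedDen p.ker).subgroupOf (warpedNum p.ker))).comp θ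
  have hker : (Subgroup.normalClosure (KSub π.ker 2 : Set (Fin 2 → F))).subgroupOf (K F 2) =
      Θ.ker := by
    ext x
    rw [Subgroup.mem_subgroupOf, mem_normalClosure_KSub_two, MonoidHom.mem_ker]
    refine Iff.trans ?_ (QuotientGroup.eq_one_iff _).symm
    rw [Subgroup.mem_subgroupOf, mem_warpedDen hp.ker_le_center]
    change _ ↔ p (φ (x.1 0)) = 1 ∧ φ (x.1 0) * φ (x.1 1) = 1
    rw [hpφ, ← map_mul]
    constructor
    · rintro ⟨h0, -, h⟩
      exact ⟨h0, commutator_top_ker_le_ker hp.ker_le_center hφ h⟩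
    · rintro ⟨h0, h⟩
      have hx := mem_K_two.1 x.2
      exact ⟨h0, (Subgroup.mul_mem_cancel_left π.ker h0).1 (hF hx),
        mem_commutator_top_ker_of_map_eq_one hG hπ hp hφ hx h⟩
  exact ⟨(QuotientGroup.quotientMulEquivOfEq hker).trans
    (QuotientGroup.quotientKerEquivOfSurjective Θ ((QuotientGroup.mk'_surjective _).comp hθ))⟩

end Cover

theorem theorem4p4 {G : Type u} [CommGroup G] [Finite G] (hG : Odd (Nat.card G)) :
    HasNaturalCover.{u, w} G ∧
      ∀ (F : Type w) [Group F] [IsFreeGroup F] (π : F →* G), Function.Surjective π →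
        ∀ (E : Type v) [Group E] (p : E →* G), IsCover p →
          warpedDen p.ker ≤ warpedNum p.ker ∧
          ∃ _ : ((warpedDen p.ker).subgroupOf (warpedNum p.ker)).Normal,
            Nonempty (KTilde π.ker 2 ≃*
              warpedNum p.ker ⧸ (warpedDen p.ker).subgroupOf (warpedNum p.ker)) := by
  refine ⟨fun F _ _ π hπ => KTilde.isCover_proj hG π hπ, fun F _ _ π hπ E _ p hp =>
    ⟨warpedDen_le_warpedNum hp.ker_le_center, ?_⟩⟩
  have := warpedDen_normal hp.ker_le_center
  exact ⟨inferInstance, nonempty_KTilde_mulEquiv hG hπ hp⟩
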